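/- Let $E=\{0,a,b,c\}$ be the non-unital, non-commutative ring of order $4$ given by $E=\langle a,b \mid 2a=2b=0,\ a^2=a,\ b^2=b,\ ab=a,\ ba=b\rangle$, with $c=a+b$. A linear $E$-code of length $n$ is a left or right $E$-submodule $C$ of $E^n$. It is called quasi self-dual if $\sum_{i=1}^n x_iy_i=0$ for all $x,y\in C$ and $|C|=2^n$, and Type IV if, moreover, every codeword has even Hamming weight. Let $C$ be a Type IV $E$-code of length $n$. Then: (1) $C$ is formally self-dual for the Hamming weight enumerator $W_C(X,Y)=\sum_{x\in C}X^{n-\mathrm{wt}(x)}Y^{\mathrm{wt}(x)}$, that is, $W_C$ equals its own MacWilliams transform, $$W_C(X,Y)=\frac{1}{|C|}\,W_C(X+3Y,\;X-Y).$$ Likewise, if $\mathbb F_4=\mathbb F_2[\omega]$ and $\phi(C)\subseteq\mathbb F_4^n$ is the additive code obtained from $C$ by the substitution $0\mapsto 0$, $a\mapsto\omega$, $b\mapsto\omega^2$, $c\mapsto 1$, then $\phi(C)$ has the same Hamming weight enumerator as its dual with respect to the trace inner product $\sum_{i=1}^n (x_iy_i^2+x_i^2y_i)$. (2) If $n\ge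 1$, the minimum Hamming distance $d$ of $C$ satisfies $$d\le 2\left(\left\lfloor \frac n6\right\rfloor+1\right).$$ This improves the earlier bound $2\lfloor\frac{n+2}{4}\rfloor$: for every $n\geq 1$ for which a Type IV $E$-code of length $n$ exists, $2(\lfloor\frac n6\rfloor+1)\le 2\lfloor\frac{n+2}{4}\rfloor$, with strict inequality whenever $n\ge 14$. -/

import Mathlib

open MvPolynomial

/-- The four elements `0, a, b, c = a + b` of the ring `E`. -/
inductive RingE : Type
  | o | a | b | c
  deriving DecidableEq

namespace RingE

instance : Fintype RingE where
  elems := {o, a, b, c}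
  complete := by intro x; cases x <;> decide

/-- Addition of `E`: characteristic two and `c = a + b`. -/
def add : RingE → RingE → RingE
  | o, y => y
  | x, o => x
  | a, a => o
  | b, b => o
  | c, c => o
  | a, b => c
  | b, a => c
  | a, c => b
  | c, a => b
  | b, c => a
  | c, b => a

/-- Multiplication of `E`, forced by `a² = a`, `b² = b`, `ab = a`, `ba = b` and distributivity:
right multiplication by `a` or `b` is the identity, right multiplication by `0` or `c` is zero. -/
def mul : RingE → RingE → RingE
  | _, o => o
  | _, c => o
  | x, a => x
  | x, b => x

instance : Zero RingE := ⟨o⟩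

instance : Add RingE := ⟨add⟩

instance : Neg RingE := ⟨id⟩

instance : Mul RingE := ⟨mul⟩

/-- `E` as a ring without identity (it is neither commutative nor unital). -/
instance : NonUnitalRing RingE where
  nsmul := nsmulRec
  zsmul := zsmulRec
  add_assoc := by decide
  zero_add := by decide
  add_zero := by decide
  add_comm := by decide
  neg_add_cancel := by decide
  left_distrib := by decide
  right_distrib := by decide
  zero_mul := by decide
  mul_zero := by decide
  mul_assoc := by decide

end RingE

/-- A linear `E`-code of length `n`: an additive subgroup of `Eⁿ` that is a left or a right
`E`-submodule. -/
def IsLinearCode {n : ℕ} (C : AddSubgroup (Fin n → RingE)) : Prop :=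
  (∀ e : RingE, ∀ x ∈ C, (fun i => e * x i) ∈ C) ∨
    (∀ e : RingE, ∀ x ∈ C, (fun i => x i * e) ∈ C)

/-- Self-orthogonality for `(x, y) = ∑ xᵢ yᵢ`. -/
def IsSelfOrthogonal {n : ℕ} (C : AddSubgroup (Fin n → RingE)) : Prop :=
  ∀ x ∈ C, ∀ y ∈ C, ∑ i, x i * y i = 0

/-- Quasi self-dual codes. -/
def IsQuasiSelfDual {n : ℕ} (C : AddSubgroup (Fin n → RingE)) : Prop :=
  IsLinearCode C ∧ IsSelfOrthogonal C ∧ Nat.card C = 2 ^ n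

/-- Type IV codes. -/
def IsTypeIV {n : ℕ} (C : AddSubgroup (Fin n → RingE)) : Prop :=
  IsQuasiSelfDual C ∧ ∀ x ∈ C, Even (hammingNorm x)

/-- The Hamming distances between distinct words of a code. -/
def codeDistances {A : Type*} [DecidableEq A] {n : ℕ} (C : Set (Fin n → A)) : Set ℕ :=
  {d | ∃ x ∈ C, ∃ y ∈ C, x ≠ y ∧ hammingDist x y = d}

/-- `d` is the minimum (Hamming) distance of the code `C`. -/
def IsMinimumDistance {A : Type*} [DecidableEq A] {n : ℕ} (C : Set (Fin n → A)) (d : ℕ) : Prop :=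
  IsLeast (codeDistances C) d

open Classical in
/-- The Hamming weight enumerator `W_C(X, Y) = ∑_{x ∈ C} X^(n - wt x) Y^(wt x)`. -/
noncomputable def hammingWeightEnumerator {A : Type*} [Finite A] [Zero A] {n : ℕ}
    (C : Set (Fin n → A)) : MvPolynomial (Fin 2) ℚ :=
  ∑ x ∈ (Set.toFinite C).toFinset, X 0 ^ (n - hammingNorm x) * X 1 ^ hammingNorm x

/-- Formal self-duality for the Hamming weight enumerator of a code over an alphabet of size four:
`W_C` is its own MacWilliams transform, `W_C(X, Y) = |C|⁻¹ W_C(X + 3 Y, X - Y)`. -/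
def IsFormallySelfDual {n : ℕ} (C : AddSubgroup (Fin n → RingE)) : Prop :=
  hammingWeightEnumerator (C : Set (Fin n → RingE)) =
    MvPolynomial.C ((Nat.card C : ℚ)⁻¹) *
      aeval ![X 0 + 3 * X 1, X 0 - X 1] (hammingWeightEnumerator (C : Set (Fin n → RingE)))

/-- The field with four elements. -/
abbrev F4 : Type := GaloisField 2 2

/-- The substitution `0 ↦ 0`, `a ↦ ω`, `b ↦ ω²`, `c ↦ 1`. -/
noncomputable def toF4 (ω : F4) : RingE → F4
  | .o => 0
  | .a => ω
  | .b => ω ^ 2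
  | .c => 1

/-- The quaternary code attached to an `E`-code by the substitution `toF4 ω`. -/
def quaternaryImage (ω : F4) {n : ℕ} (C : AddSubgroup (Fin n → RingE)) : Set (Fin n → F4) :=
  (fun x i => toF4 ω (x i)) '' (C : Set (Fin n → RingE))

/-- The dual of an additive quaternary code for the trace inner product
`∑ Tr(xᵢ ȳᵢ) = ∑ (xᵢ yᵢ² + xᵢ² yᵢ)`. -/
def traceDual {n : ℕ} (D : Set (Fin n → F4)) : Set (Fin n → F4) :=
  {y | ∀ x ∈ D, ∑ i, (x i * y i ^ 2 + x i ^ 2 * y i) = 0}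

/-! Additively E is 𝔽₂², and xy is x scaled by the `a`-coordinate of y. Self-orthogonality therefore
forces a symplectic form to vanish on C, and |C| = 2ⁿ makes C its own symplectic dual
(`IsQuasiSelfDual.sympDual_eq`). Fourier inversion gives `macWilliams`; the substitution into 𝔽₄
turns the symplectic form into the trace form. For the bound, n = 2N is even, and P(y) = ∑ y^(wt/2)
is invariant under the MacWilliams substitution. As in Gleason's theorem, P/(1+3y)^N is a polynomial
in t = y(1-y)²/(1+3y)³ of degree at most N/3. For m = N/3 + 1 its t^m-coefficient is zero; Lagrange
inversion writes this as a linear relation among the coefficients of P up to degree m. If P = 1 +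
O(y^(m+1)), the relation would equate a negative number with zero. -/

namespace RingE

/-! ### Coordinates and the symplectic form -/

/-- The coefficient of `a` in the basis `a, c` of `E` over `𝔽₂`. -/
def coordA : RingE →+ ZMod 2 where
  toFun x := match x with
    | o => 0 | a => 1 | b => 1 | c => 0
  map_zero' := rfl
  map_add' := by decide

/-- The coefficient of `c` in the basis `a, c` of `E` over `𝔽₂`. -/
def coordC : RingE →+ ZMod 2 where
  toFun x := match x with
    | o => 0 | a => 0 | b => 1 | c => 1
  map_zero' := rfl
  map_add' := by decide

theorem coordA_mul (x y : RingE) : coordA (x * y) = coordA x * coordA y := by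
  revert x y; decide

theorem coordC_mul (x y : RingE) : coordC (x * y) = coordC x * coordA y := by
  revert x y; decide

/-- The symplectic form on `Eⁿ`. -/
def symp {n : ℕ} (y : Fin n → RingE) : (Fin n → RingE) →+ ZMod 2 where
  toFun x := ∑ i, (coordA (x i) * coordC (y i) + coordC (x i) * coordA (y i))
  map_zero' := by simp
  map_add' x x' := by
    rw [← Finset.sum_add_distrib]
    refine Finset.sum_congr rfl fun i _ => ?_
    simp only [Pi.add_apply, map_add]
    ring

theorem symp_apply {n : ℕ} (y x : Fin n → RingE) :
    symp y x = ∑ i, (coordA (x i) * coordC (y i) + coordC (x i) * coordA (y i)) := rfl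

theorem symp_comm {n : ℕ} (x y : Fin n → RingE) : symp y x = symp x y := by
  simp only [symp_apply]
  exact Finset.sum_congr rfl fun i _ => by ring

theorem symp_single {n : ℕ} (y : Fin n → RingE) (i : Fin n) (e : RingE) :
    symp y (Pi.single i e) = coordA e * coordC (y i) + coordC e * coordA (y i) := by
  rw [symp_apply, Finset.sum_eq_single i]
  · simp
  · intro j _ hj
    simp [Pi.single_eq_of_ne hj]
  · simp

theorem symp_eq_zero_iff {n : ℕ} (y : Fin n → RingE) : (∀ x, symp y x = 0) ↔ y = 0 := by
  refine ⟨fun h => ?_, ?_⟩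
  · funext i
    have h1 := h (Pi.single i a)
    have h2 := h (Pi.single i c)
    rw [symp_single] at h1 h2
    revert h1 h2
    change _ → _ → y i = 0
    generalize y i = e at *
    revert e
    decide
  · rintro rfl x
    simp [symp_apply]

end RingE

open RingE

/-! ### Character sums -/

section Sign

variable {R : Type*} [CommRing R]

/-- The nontrivial additive character of `𝔽₂`. -/
def signChar (R : Type*) [CommRing R] (t : ZMod 2) : R := if t = 0 then 1 else -1

theorem signChar_zero : signChar R 0 = 1 := if_pos rfl

theorem signChar_add (s t : ZMod 2) : signChar R (s + t) = signChar R s * signChar R t := by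
  have h2 : (1 : ZMod 2) + 1 = 0 := by decide
  have h (t : ZMod 2) : t = 0 ∨ t = 1 := by revert t; decide
  rcases h s with rfl | rfl <;> rcases h t with rfl | rfl <;> simp [signChar, h2]

theorem signChar_sum {ι : Type*} (s : Finset ι) (f : ι → ZMod 2) :
    signChar R (∑ i ∈ s, f i) = ∏ i ∈ s, signChar R (f i) := by
  classical
  induction s using Finset.induction_on with
  | empty => simp [signChar_zero]
  | insert i s hi ih => rw [Finset.sum_insert hi, Finset.prod_insert hi, signChar_add, ih]

/-- Translating by a vector where f is nonzero flips every sign. -/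
theorem sum_signChar_eq_zero [NoZeroDivisors R] [CharZero R] {V : Type*} [AddCommGroup V]
    [Fintype V] (f : V →+ ZMod 2) (hf : ∃ v, f v ≠ 0) : ∑ v, signChar R (f v) = 0 := by
  obtain ⟨v, hv⟩ := hf
  have h : ∑ w, signChar R (f w) = -∑ w, signChar R (f w) := by
    conv_lhs => rw [← Equiv.sum_comp (Equiv.addRight v)]
    rw [← Finset.sum_neg_distrib]
    refine Finset.sum_congr rfl fun w _ => ?_
    rw [Equiv.coe_addRight, map_add, signChar_add, signChar, signChar, if_neg hv]
    ring
  exact self_eq_neg.mp h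

theorem sum_signChar_eq_card {V : Type*} [AddCommGroup V]
    [Fintype V] (f : V →+ ZMod 2) (hf : ∀ v, f v = 0) :
    ∑ v, signChar R (f v) = Nat.card V := by
  simp [hf, signChar_zero]

end Sign

/-! ### Symplectic duality -/

/-- The symplectic dual of a code. -/
def sympDual {n : ℕ} (C : AddSubgroup (Fin n → RingE)) : Set (Fin n → RingE) :=
  {y | ∀ x ∈ C, symp y x = 0}

open Classical in
theorem sum_signChar_symp (R : Type*) [CommRing R] [NoZeroDivisors R] [CharZero R] {n : ℕ}
    (C : AddSubgroup (Fin n → RingE)) [Fintype C] (y : Fin n → RingE) :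
    ∑ x : C, signChar R (symp y x) = if y ∈ sympDual C then (Nat.card C : R) else 0 := by
  split_ifs with h
  · exact sum_signChar_eq_card ((symp y).comp C.subtype) fun v => h v v.2
  · refine sum_signChar_eq_zero ((symp y).comp C.subtype) ?_
    by_contra! hc
    exact h fun x hx => hc ⟨x, hx⟩

/-- Both sides evaluate the double character sum over C × Eⁿ: summing over C first detects the dual,
summing over Eⁿ first leaves only x = 0. -/
theorem card_mul_card_sympDual {n : ℕ} (C : AddSubgroup (Fin n → RingE)) :
    Nat.card C * (sympDual C).ncard = 4 ^ n := by
  classical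
  have h1 : ∑ y : Fin n → RingE, ∑ x : C, signChar ℤ (symp y x) =
      Nat.card C * (sympDual C).ncard := by
    simp only [sum_signChar_symp]
    rw [← Finset.sum_filter, Finset.sum_const, nsmul_eq_mul, mul_comm,
      Set.ncard_eq_toFinset_card']
    congr 3
    ext y
    simp
  have h2 : ∑ x : C, ∑ y : Fin n → RingE, signChar ℤ (symp y x) = 4 ^ n := by
    rw [Finset.sum_eq_single (0 : C)]
    · simp only [ZeroMemClass.coe_zero, map_zero, signChar_zero]
      simp [show Fintype.card RingE = 4 from rfl]
    · intro x _ hx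
      simp only [symp_comm (x : Fin n → RingE)]
      refine sum_signChar_eq_zero (symp (x : Fin n → RingE)) ?_
      by_contra! hc
      exact hx (Subtype.ext ((symp_eq_zero_iff _).mp hc))
    · simp
  rw [Finset.sum_comm, h2] at h1
  exact_mod_cast h1.symm

/-- The form is the `c`-coordinate of (x, y) + (y, x). -/
theorem IsSelfOrthogonal.symp_eq_zero {n : ℕ} {C : AddSubgroup (Fin n → RingE)}
    (hC : IsSelfOrthogonal C) {x y : Fin n → RingE} (hx : x ∈ C) (hy : y ∈ C) :
    symp y x = 0 := by
  have h1 := congrArg coordC (hC x hx y hy)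
  have h2 := congrArg coordC (hC y hy x hx)
  simp only [map_sum, coordC_mul, map_zero] at h1 h2
  rw [symp_apply, Finset.sum_add_distrib, h1, add_zero, ← h2]
  exact Finset.sum_congr rfl fun i _ => mul_comm _ _

theorem IsQuasiSelfDual.sympDual_eq {n : ℕ} {C : AddSubgroup (Fin n → RingE)}
    (hC : IsQuasiSelfDual C) : sympDual C = C := by
  symm
  refine Set.eq_of_subset_of_ncard_le (fun y hy x hx => hC.2.1.symp_eq_zero hx hy) ?_
    (Set.toFinite _)
  have h := card_mul_card_sympDual C
  rw [hC.2.2, show 4 ^ n = 2 ^ n * 2 ^ n by rw [← mul_pow]; rfl] at h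
  rw [Nat.eq_of_mul_eq_mul_left (by positivity) h, ← hC.2.2]
  exact le_of_eq (Nat.card_coe_set_eq _)

/-! ### MacWilliams identity -/

theorem prod_ite_eq_pow_hammingNorm {R A : Type*} [CommRing R] [Zero A] [DecidableEq A] {n : ℕ}
    (x : Fin n → A) (s t : R) :
    ∏ i, (if x i = 0 then s else t) = s ^ (n - hammingNorm x) * t ^ hammingNorm x := by
  rw [Finset.prod_ite, Finset.prod_const, Finset.prod_const]
  have h := Finset.card_filter_add_card_filter_not (s := Finset.univ) (fun i => x i = 0)
  rw [Finset.card_univ, Fintype.card_fin] at h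
  have h2 : hammingNorm x = (Finset.univ.filter fun i => ¬ x i = 0).card := rfl
  rw [h2, show (Finset.univ.filter fun i => x i = 0).card =
    n - (Finset.univ.filter fun i => ¬ x i = 0).card by omega]

theorem hammingWeightEnumerator_eq_sum {n : ℕ} (C : AddSubgroup (Fin n → RingE)) [Fintype C] :
    hammingWeightEnumerator (C : Set (Fin n → RingE)) =
      ∑ x : C, X 0 ^ (n - hammingNorm (x : Fin n → RingE)) *
        X 1 ^ hammingNorm (x : Fin n → RingE) := by
  rw [hammingWeightEnumerator, Finset.sum_subtype (p := (· ∈ C)) _ (by simp)]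
  refine Finset.sum_congr rfl fun x _ => ?_
  congr!

/-- This is the Fourier transform at a single coordinate. -/
theorem sum_signChar_mul_ite {R : Type*} [CommRing R] (e : RingE) (s t : R) :
    ∑ f : RingE, signChar R (coordA e * coordC f + coordC e * coordA f) *
      (if f = 0 then s else t) = if e = 0 then s + 3 * t else s - t := by
  have h : (Finset.univ : Finset RingE) = {o, a, b, c} := rfl
  rw [h]
  cases e <;> simp [coordA, coordC, signChar, show (o : RingE) = 0 from rfl,
    show (a : RingE) ≠ 0 by decide, show (b : RingE) ≠ 0 by decide,
    show (c : RingE) ≠ 0 by decide, show (1 + 1 : ZMod 2) = 0 by decide] <;> ring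

/-- The MacWilliams identity for a code equal to its symplectic dual, as an identity of values in any domain of
characteristic zero. -/
theorem macWilliams {R : Type*} [CommRing R] [NoZeroDivisors R] [CharZero R] {n : ℕ}
    {C : AddSubgroup (Fin n → RingE)} [Fintype C] (hC : sympDual C = C) (s t : R) :
    ∑ x : C, (s + 3 * t) ^ (n - hammingNorm (x : Fin n → RingE)) *
        (s - t) ^ hammingNorm (x : Fin n → RingE) =
      Nat.card C * ∑ x : C, s ^ (n - hammingNorm (x : Fin n → RingE)) *
        t ^ hammingNorm (x : Fin n → RingE) := by
  classical
  simp only [← prod_ite_eq_pow_hammingNorm]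
  have key (x : C) : ∏ i, (if (x : Fin n → RingE) i = 0 then s + 3 * t else s - t) =
      ∑ y : Fin n → RingE, signChar R (symp y x) * ∏ i, (if y i = 0 then s else t) := by
    simp only [← sum_signChar_mul_ite]
    rw [Finset.prod_univ_sum, Fintype.piFinset_univ]
    refine Finset.sum_congr rfl fun y _ => ?_
    rw [symp_apply, signChar_sum, Finset.prod_mul_distrib]
  simp only [key]
  rw [Finset.sum_comm]
  simp only [← Finset.sum_mul, sum_signChar_symp, hC, ite_mul, zero_mul]
  rw [← Finset.sum_filter, ← Finset.mul_sum]
  congr 1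
  exact Finset.sum_subtype _ (by simp) _

theorem IsQuasiSelfDual.isFormallySelfDual {n : ℕ} {C : AddSubgroup (Fin n → RingE)}
    (hC : IsQuasiSelfDual C) : IsFormallySelfDual C := by
  have := Fintype.ofFinite C
  have hcard : (Nat.card C : ℚ) ≠ 0 := by rw [hC.2.2]; positivity
  rw [IsFormallySelfDual, hammingWeightEnumerator_eq_sum]
  simp only [map_sum, map_mul, map_pow, aeval_X, Matrix.cons_val_zero, Matrix.cons_val_one]
  rw [macWilliams hC.sympDual_eq, ← mul_assoc, ← map_natCast (MvPolynomial.C (R := ℚ)), ← map_mul,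
    inv_mul_cancel₀ hcard, map_one, one_mul]

/-! ### Parity of the length -/

theorem natCast_hammingNorm {n : ℕ} (x : Fin n → RingE) :
    (hammingNorm x : ZMod 2) =
      ∑ i, (coordA (x i) + coordC (x i) + coordA (x i) * coordC (x i)) := by
  rw [hammingNorm, ← Finset.sum_boole]
  refine Finset.sum_congr rfl fun i _ => ?_
  generalize x i = e
  revert e
  decide

/-- Modulo 2 the weight is ∑A + ∑C + ∑AC in coordinates. Self-orthogonality kills ∑A and ∑AC, so ∑C
= 0, which says that the all-`a` word is orthogonal to C. It thus lies in C, and its weight is n. -/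
theorem IsTypeIV.even_length {n : ℕ} {C : AddSubgroup (Fin n → RingE)} (hC : IsTypeIV C) :
    Even n := by
  have hmem : (fun _ => a : Fin n → RingE) ∈ C := by
    rw [← SetLike.mem_coe, ← hC.1.sympDual_eq]
    intro x hx
    have h1 := congrArg coordA (hC.1.2.1 x hx x hx)
    have h2 := congrArg coordC (hC.1.2.1 x hx x hx)
    have h3 := (ZMod.natCast_eq_zero_iff_even).mpr (hC.2 x hx)
    simp only [map_sum, coordC_mul, coordA_mul, map_zero] at h1 h2
    rw [natCast_hammingNorm, Finset.sum_add_distrib, Finset.sum_add_distrib] at h3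
    have h4 : ∑ i, coordA (x i) * coordA (x i) = ∑ i, coordA (x i) :=
      Finset.sum_congr rfl fun i _ => by generalize coordA (x i) = t; revert t; decide
    have h5 : ∑ i, coordA (x i) * coordC (x i) = 0 := by
      rw [← h2]
      exact Finset.sum_congr rfl fun i _ => mul_comm _ _
    rw [h5, ← h4, h1, zero_add, add_zero] at h3
    rw [symp_apply, ← h3]
    refine Finset.sum_congr rfl fun i _ => ?_
    generalize x i = e
    revert e
    decide
  have h := hC.2 _ hmem
  have h6 : hammingNorm (fun _ => a : Fin n → RingE) = n := by
    simp [hammingNorm, show (a : RingE) ≠ 0 by decide]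
  rwa [h6] at h

/-! ### Transfer to the trace form over 𝔽₄ -/

section TraceForm

variable {ω : F4}

theorem toF4_injective (hω : ω ^ 2 + ω + 1 = 0) : Function.Injective (toF4 ω) := by
  have h0 : ω ≠ 0 := by rintro rfl; simp at hω
  have h2 : (2 : F4) = 0 := CharTwo.two_eq_zero
  have h1 : ω ≠ 1 := by
    rintro rfl
    have h3 : (1 : F4) = 0 := by linear_combination hω - h2
    exact one_ne_zero h3
  have h3 : ω ^ 2 ≠ ω := fun h => by
    rcases mul_eq_zero.mp (show ω * (ω - 1) = 0 by linear_combination h) with h | h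
    · exact h0 h
    · exact h1 (sub_eq_zero.mp h)
  have h4 : ω ^ 2 ≠ 1 := fun h => h0 (by linear_combination hω - h - h2)
  intro x y hxy
  have h5 := pow_ne_zero 2 h0
  have h6 := one_ne_zero (α := F4)
  cases x <;> cases y <;> first
    | rfl
    | (simp only [toF4] at hxy
       first
        | exact absurd hxy (by assumption)
        | exact absurd hxy.symm (by assumption))

theorem toF4_surjective (hω : ω ^ 2 + ω + 1 = 0) : Function.Surjective (toF4 ω) := by
  refine ((Nat.bijective_iff_injective_and_card _).mpr ⟨toF4_injective hω, ?_⟩).2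
  rw [GaloisField.card 2 2 two_ne_zero, Nat.card_eq_fintype_card]
  rfl

theorem trace_toF4 (hω : ω ^ 2 + ω + 1 = 0) (x y : RingE) :
    toF4 ω x * toF4 ω y ^ 2 + toF4 ω x ^ 2 * toF4 ω y =
      algebraMap (ZMod 2) F4 (coordA x * coordC y + coordC x * coordA y) := by
  have h2 : (2 : F4) = 0 := CharTwo.two_eq_zero
  have h3 : ω ^ 3 = 1 := by linear_combination (ω - 1) * hω
  have h4 : ω + ω ^ 2 = 1 := by linear_combination hω - h2
  have h5 : ω ^ 4 = ω := by linear_combination ω * h3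
  have h6 : ω ^ 5 = ω ^ 2 := by linear_combination ω ^ 2 * h3
  have h8 : (1 : ZMod 2) + 1 = 0 := by decide
  cases x <;> cases y <;> simp [toF4, coordA, coordC, h8] <;>
    ring_nf <;> simp [h3, h4, h5, h6, h2] <;> linear_combination h4

theorem traceDual_quaternaryImage (hω : ω ^ 2 + ω + 1 = 0) {n : ℕ}
    (C : AddSubgroup (Fin n → RingE)) :
    traceDual (quaternaryImage ω C) = (fun x i => toF4 ω (x i)) '' sympDual C := by
  have key (x y : Fin n → RingE) :
      ∑ i, (toF4 ω (x i) * toF4 ω (y i) ^ 2 + toF4 ω (x i) ^ 2 * toF4 ω (y i)) = 0 ↔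
        symp y x = 0 := by
    simp only [trace_toF4 hω]
    rw [← map_sum, map_eq_zero]
    rfl
  ext y
  obtain ⟨z, rfl⟩ : ∃ z : Fin n → RingE, (fun i => toF4 ω (z i)) = y :=
    ⟨_, funext fun i => (toF4_surjective hω (y i)).choose_spec⟩
  constructor
  · exact fun h => ⟨z, fun x hx => (key x z).mp (h _ ⟨x, hx, rfl⟩), rfl⟩
  · rintro ⟨w, hw, hwz⟩
    rw [← hwz]
    rintro _ ⟨x, hx, rfl⟩
    exact (key x w).mpr (hw x hx)

end TraceForm

/-! ### Lagrange inversion -/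

namespace PowerSeries

theorem derivative_mk_one :
    d⁄dX ℚ (mk 1 : ℚ⟦X⟧) = mk 1 ^ 2 := by
  have h : (mk 1 : ℚ⟦X⟧) * (1 - X) = 1 := mk_one_mul_one_sub_eq_one ℚ
  have h1 := congrArg (d⁄dX ℚ) h
  simp only [Derivation.leibniz, map_sub, derivative_X, Derivation.map_one_eq_zero, smul_eq_mul]
    at h1
  linear_combination (mk 1 : ℚ⟦X⟧) * h1 - d⁄dX ℚ (mk 1 : ℚ⟦X⟧) * h

theorem coeff_X_mul_derivative (f : ℚ⟦X⟧) (m : ℕ) :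
    coeff m (X * d⁄dX ℚ f) = m * coeff m f := by
  cases m with
  | zero => simp
  | succ m =>
    rw [coeff_succ_X_mul, coeff_derivative]
    push_cast
    ring

/-- The integration by parts behind Lagrange inversion for `y (1 - y)² / (1 + 3 y)³`. -/
theorem coeff_lagrange (m N e : ℕ) (h : e + N + 1 = 3 * m) :
    (m : ℚ) * coeff m ((1 + 3 * X : ℚ⟦X⟧) ^ e * (1 - 9 * X) * mk 1 ^ (2 * m + 1)) =
      -(3 * N) * coeff m (X * ((1 + 3 * X : ℚ⟦X⟧) ^ e * mk 1 ^ (2 * m))) := by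
  have hG : (mk 1 : ℚ⟦X⟧) * (1 - X) = 1 := mk_one_mul_one_sub_eq_one ℚ
  have hm : (e : ℚ⟦X⟧) + N + 1 = 3 * m := by exact_mod_cast congrArg (Nat.cast (R := ℚ⟦X⟧)) h
  -- The series `mk 1` is 1/(1-X). Expanding X·F′ for this product F and comparing m-th coefficients
  -- gives the claim.
  have hd := coeff_X_mul_derivative ((1 + 3 * X : ℚ⟦X⟧) ^ (e + 1) * mk 1 ^ (2 * m)) m
  have h3 : d⁄dX ℚ (3 : ℚ⟦X⟧) = 0 := by
    simpa using (d⁄dX ℚ).map_natCast 3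
  obtain ⟨k, rfl⟩ : ∃ k, m = k + 1 := ⟨m - 1, by omega⟩
  have hD : X * d⁄dX ℚ ((1 + 3 * X : ℚ⟦X⟧) ^ (e + 1) * mk 1 ^ (2 * (k + 1))) =
      (k + 1 : ℕ) • ((1 + 3 * X : ℚ⟦X⟧) ^ (e + 1) * mk 1 ^ (2 * (k + 1))) -
      (k + 1 : ℕ) • ((1 + 3 * X : ℚ⟦X⟧) ^ e * (1 - 9 * X) * mk 1 ^ (2 * (k + 1) + 1)) -
      (3 * N : ℕ) • (X * ((1 + 3 * X : ℚ⟦X⟧) ^ e * mk 1 ^ (2 * (k + 1)))) := by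
    rw [Derivation.leibniz, Derivation.leibniz_pow, Derivation.leibniz_pow, derivative_mk_one]
    simp only [map_add, Derivation.leibniz, derivative_X, Derivation.map_one_eq_zero, h3,
      smul_eq_mul, nsmul_eq_mul]
    rw [show 2 * (k + 1) - 1 = 2 * k + 1 by omega, show e + 1 - 1 = e by omega]
    push_cast at hm ⊢
    have hN : (N : ℚ⟦X⟧) = 3 * (k + 1) - 1 - e := by linear_combination hm
    rw [hN]
    generalize (mk 1 : ℚ⟦X⟧) = G at *
    linear_combination (1 + 3 * X) ^ e * G ^ (2 * k + 2) * (k + 1) * (1 - 6 * X) * hG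
  rw [hD] at hd
  simp only [map_sub, map_nsmul] at hd
  simp only [nsmul_eq_mul] at hd
  push_cast at hd ⊢
  linear_combination -hd

/-- After integration by parts, the remaining series has nonnegative factors, and its relevant
coefficient is positive. -/
theorem coeff_lagrange_ne_zero {m N e : ℕ} (h : e + N + 1 = 3 * m) (hN : 0 < N) :
    coeff m ((1 + 3 * X : ℚ⟦X⟧) ^ e * (1 - 9 * X) * mk 1 ^ (2 * m + 1)) ≠ 0 := by
  obtain ⟨k, rfl⟩ : ∃ k, m = k + 1 := ⟨m - 1, by omega⟩
  intro h0
  have key := coeff_lagrange (k + 1) N e h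
  rw [h0, mul_zero, coeff_succ_X_mul] at key
  have hA (i : ℕ) : 0 ≤ coeff i ((1 + 3 * X : ℚ⟦X⟧) ^ e) := by
    clear key h0 h
    induction e generalizing i with
    | zero =>
      rw [pow_zero, coeff_one]
      split_ifs <;> norm_num
    | succ e ih =>
      rw [pow_succ, mul_add, mul_one, ← mul_assoc, map_add]
      refine add_nonneg (ih i) ?_
      cases i with
      | zero => simp
      | succ i =>
        rw [coeff_succ_mul_X, mul_comm, show (3 : ℚ⟦X⟧) = C 3 from (map_ofNat C 3).symm,
          coeff_C_mul]
        exact mul_nonneg (by norm_num) (ih i)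
  have hB (j i : ℕ) : 0 < coeff i ((mk 1 : ℚ⟦X⟧) ^ (j + 1)) := by
    rw [mk_one_pow_eq_mk_choose_add, coeff_mk]
    exact_mod_cast Nat.choose_pos (by omega)
  have hpos : 0 < coeff k ((1 + 3 * X : ℚ⟦X⟧) ^ e * mk 1 ^ (2 * (k + 1))) := by
    rw [coeff_mul]
    refine Finset.sum_pos' (fun p _ => mul_nonneg (hA _) (hB (2 * k + 1) _).le)
      ⟨(0, k), by simp, ?_⟩
    refine mul_pos ?_ (hB (2 * k + 1) _)
    simp [coeff_zero_eq_constantCoeff]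
  have : (0 : ℚ) < 3 * N := by positivity
  nlinarith [mul_pos this hpos]

end PowerSeries

/-! ### Gleason-type reduction of invariant polynomials -/

namespace Polynomial

/-- Invariance of `P (y²)` under the MacWilliams substitution `y ↦ (1 - y) / (1 + 3 y)` in
degree `2 N`, away from finitely many points. -/
def IsMacWilliamsInvariant (N : ℕ) (P : ℚ[X]) : Prop :=
  ∀ x : ℚ, x ≠ 0 → x ≠ 1 → x ≠ -1 → 1 + 3 * x ≠ 0 →
    (1 + 3 * x) ^ (2 * N) * P.eval (((1 - x) / (1 + 3 * x)) ^ 2) = 4 ^ N * P.eval (x ^ 2)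

theorem eq_at_one_of_eq_punctured {f g : ℚ → ℚ} (hf : ContinuousAt f 1) (hg : ContinuousAt g 1)
    (h : ∀ x : ℚ, x ≠ 0 → x ≠ 1 → x ≠ -1 → 1 + 3 * x ≠ 0 → f x = g x) : f 1 = g 1 := by
  have h1 : ∀ᶠ x : ℚ in nhdsWithin 1 {1}ᶜ, f x = g x := by
    rw [eventually_nhdsWithin_iff]
    filter_upwards [lt_mem_nhds (show (0 : ℚ) < 1 by norm_num)] with x hx hx1
    exact h x hx.ne' hx1 (by linarith) (by positivity)
  exact ((hf.eventuallyEq_nhds_iff_eventuallyEq_nhdsNE hg).mp h1).eq_of_nhds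

theorem IsMacWilliamsInvariant.sub {N : ℕ} {P Q : ℚ[X]} (hP : IsMacWilliamsInvariant N P)
    (hQ : IsMacWilliamsInvariant N Q) : IsMacWilliamsInvariant N (P - Q) := by
  intro x h0 h1 h2 h3
  rw [eval_sub, eval_sub, mul_sub, mul_sub, hP x h0 h1 h2 h3, hQ x h0 h1 h2 h3]

/-- Rests on (1+3x)² + 3(1-x)² = 4(1+3x²). -/
theorem isMacWilliamsInvariant_pow (N : ℕ) (r : ℚ) :
    IsMacWilliamsInvariant N (C r * (1 + 3 * X) ^ N) := by
  intro x _ _ _ h3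
  simp only [eval_mul, eval_C, eval_pow, eval_add, eval_one, eval_X, eval_ofNat]
  rw [pow_mul, mul_left_comm, ← mul_pow, mul_left_comm, ← mul_pow]
  congr 2
  field_simp
  ring

/-- An invariant polynomial vanishing at `0` is divisible by the invariant `y (1 - y)²`. -/
theorem IsMacWilliamsInvariant.exists_eq_mul {N : ℕ} {P : ℚ[X]} (hP : IsMacWilliamsInvariant N P)
    (h0 : P.eval 0 = 0) : ∃ Q : ℚ[X], P = X * (1 - X) ^ 2 * Q := by
  have hu : ContinuousAt (fun x : ℚ => ((1 - x) / (1 + 3 * x)) ^ 2) 1 := by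
    refine ContinuousAt.pow (ContinuousAt.div ?_ ?_ (by norm_num)) 2 <;> fun_prop
  obtain ⟨R, rfl⟩ : X ∣ P := by
    rw [X_dvd_iff, coeff_zero_eq_eval_zero, h0]
  -- The substitution sends 1 to 0, so letting x → 1 carries the zero at 0 to y = 1.
  have hR : R.eval 1 = 0 := by
    have h := eq_at_one_of_eq_punctured
      (ContinuousAt.mul (by fun_prop) ((X * R).continuous.continuousAt.comp hu))
      (by fun_prop) hP
    simpa using h
  obtain ⟨S, rfl⟩ : (1 - X) ∣ R := by
    have h := dvd_iff_isRoot.mpr hR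
    rw [← neg_dvd, neg_sub] at h
    simpa using h
  -- The root is double: near x = 1 the left side vanishes to order two, since it involves the
  -- square of (1-x)/(1+3x), while 1 - x² has a simple zero. Cancelling x(1-x)(1+x) leaves a factor
  -- 1 - x on the left only.
  have hS : S.eval 1 = 0 := by
    have h := eq_at_one_of_eq_punctured
      (f := fun x => (1 + 3 * x) ^ (2 * N) * (1 - x) * 8 / (1 + 3 * x) ^ 4 *
        S.eval (((1 - x) / (1 + 3 * x)) ^ 2))
      (g := fun x => 4 ^ N * (x * S.eval (x ^ 2)))
      (ContinuousAt.mul (ContinuousAt.div (by fun_prop) (by fun_prop) (by norm_num))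
        (S.continuous.continuousAt.comp hu)) (by fun_prop) ?_
    · simpa using h
    · intro x hx0 hx1 hx2 hx3
      have h := hP x hx0 hx1 hx2 hx3
      simp only [eval_mul, eval_X, eval_sub, eval_one] at h
      have hx : x * (1 - x) * (1 + x) ≠ 0 :=
        mul_ne_zero (mul_ne_zero hx0 (sub_ne_zero.mpr hx1.symm))
          (fun h => hx2 (by linear_combination h))
      refine mul_left_cancel₀ hx ?_
      have e : ((1 - x) / (1 + 3 * x)) ^ 2 * (1 - ((1 - x) / (1 + 3 * x)) ^ 2) =
          x * (1 - x) * (1 + x) * ((1 - x) * 8 / (1 + 3 * x) ^ 4) := by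
        rw [div_pow, one_sub_div (pow_ne_zero 2 hx3), div_mul_div_comm, ← pow_add,
          ← mul_div_assoc]
        congr 1
        ring
      rw [← mul_assoc (((1 - x) / (1 + 3 * x)) ^ 2), e] at h
      linear_combination h
  obtain ⟨Q, rfl⟩ : (1 - X) ∣ S := by
    have h := dvd_iff_isRoot.mpr hS
    rw [← neg_dvd, neg_sub] at h
    simpa using h
  exact ⟨Q, by ring⟩

theorem IsMacWilliamsInvariant.of_mul {N : ℕ} {Q : ℚ[X]}
    (h : IsMacWilliamsInvariant (N + 3) (X * (1 - X) ^ 2 * Q)) : IsMacWilliamsInvariant N Q := by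
  intro x h0 h1 h2 h3
  have hx := h x h0 h1 h2 h3
  simp only [eval_mul, eval_X, eval_sub, eval_one, eval_pow] at hx
  have hne : 64 * (x * (1 - x) * (1 + x)) ^ 2 ≠ 0 :=
    mul_ne_zero (by norm_num) (pow_ne_zero 2 (mul_ne_zero (mul_ne_zero h0 (sub_ne_zero.mpr h1.symm))
      (fun h => h2 (by linear_combination h))))
  refine mul_left_cancel₀ hne ?_
  -- The constant is 64 = 4³, matching the drop from N + 3 to N.
  have e : (1 + 3 * x) ^ 6 *
      (((1 - x) / (1 + 3 * x)) ^ 2 * (1 - ((1 - x) / (1 + 3 * x)) ^ 2) ^ 2) =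
        64 * (x * (1 - x) * (1 + x)) ^ 2 := by
    field_simp
    ring
  linear_combination hx - (1 + 3 * x) ^ (2 * N) * eval (((1 - x) / (1 + 3 * x)) ^ 2) Q * e

theorem natDegree_X_mul_one_sub_X_sq_mul {Q : ℚ[X]} (hQ : Q ≠ 0) :
    (X * (1 - X) ^ 2 * Q).natDegree = Q.natDegree + 3 := by
  have h1 : (1 - X : ℚ[X]).natDegree = 1 := by
    rw [← neg_sub, natDegree_neg]
    exact natDegree_X_sub_C 1
  have h2 : (1 - X : ℚ[X]) ≠ 0 := ne_zero_of_natDegree_gt (n := 0) (by omega)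
  rw [natDegree_mul (mul_ne_zero X_ne_zero (pow_ne_zero 2 h2)) hQ,
    natDegree_mul X_ne_zero (pow_ne_zero 2 h2), natDegree_pow, h1, natDegree_X]
  ring

/-- The linear relation satisfied by the coefficients of all invariant polynomials, obtained from
Gleason's theorem and Lagrange inversion. -/
theorem IsMacWilliamsInvariant.coeff_eq_zero (m : ℕ) : ∀ {N e : ℕ} {P : ℚ[X]},
    e + N + 1 = 3 * m → P.natDegree ≤ N → IsMacWilliamsInvariant N P →
    PowerSeries.coeff m ((P : PowerSeries ℚ) * ((1 + 3 * PowerSeries.X) ^ e *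
      (1 - 9 * PowerSeries.X) * PowerSeries.mk 1 ^ (2 * m + 1))) = 0 := by
  induction m with
  | zero => intro N e P h; omega
  | succ m ih =>
    intro N e P h hdeg hP
    -- Subtracting P(0)(1+3y)^N leaves y(1-y)²Q; passing to Q lowers N by 3 and m by 1 while e stays
    -- fixed.
    obtain ⟨Q, hQ⟩ := (hP.sub (isMacWilliamsInvariant_pow N (P.eval 0))).exists_eq_mul (by simp)
    have hinv := hP.sub (isMacWilliamsInvariant_pow N (P.eval 0))
    have hdeg' : (P - C (P.eval 0) * (1 + 3 * X) ^ N).natDegree ≤ N := by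
      refine (natDegree_sub_le_of_le hdeg ((natDegree_C_mul_le _ _).trans ?_)).trans (max_self N).le
      refine (natDegree_pow_le_of_le N (m := 1) ?_).trans (by simp)
      compute_degree
    rw [hQ] at hdeg' hinv
    have hQ0 : PowerSeries.coeff (m + 1) (((X * (1 - X) ^ 2 * Q : ℚ[X]) : PowerSeries ℚ) *
        ((1 + 3 * PowerSeries.X) ^ e * (1 - 9 * PowerSeries.X) *
          PowerSeries.mk 1 ^ (2 * (m + 1) + 1))) = 0 := by
      by_cases hQz : Q = 0
      · simp [hQz]
      rw [natDegree_X_mul_one_sub_X_sq_mul hQz] at hdeg'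
      obtain ⟨M, rfl⟩ : ∃ M, N = M + 3 := ⟨N - 3, by omega⟩
      have key := ih (e := e) (by omega) (show Q.natDegree ≤ M by omega) hinv.of_mul
      refine Eq.trans ?_ ((PowerSeries.coeff_succ_X_mul m _).trans key)
      congr 1
      push_cast
      have hG := PowerSeries.mk_one_mul_one_sub_eq_one ℚ
      generalize (PowerSeries.mk 1 : PowerSeries ℚ) = G at *
      have hG2 : G ^ 2 * (1 - PowerSeries.X) ^ 2 = 1 := by rw [← mul_pow, hG, one_pow]
      linear_combination (PowerSeries.X * (Q : PowerSeries ℚ) * (1 + 3 * PowerSeries.X) ^ e *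
        (1 - 9 * PowerSeries.X) * G ^ (2 * m + 1)) * hG2
    -- The subtracted power is absorbed into the exponent e + N; with 0 in place of N the right-hand
    -- side vanishes.
    have hpow := PowerSeries.coeff_lagrange (m + 1) 0 (e + N) (by omega)
    rw [Nat.cast_zero, mul_zero, neg_zero, zero_mul, mul_eq_zero] at hpow
    replace hpow := hpow.resolve_left (by positivity)
    rw [sub_eq_iff_eq_add.mp hQ]
    rw [coe_add, add_mul, map_add, hQ0, zero_add]
    have hcoe : ((C (P.eval 0) * (1 + 3 * X) ^ N : ℚ[X]) : PowerSeries ℚ) =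
        PowerSeries.C (P.eval 0) * (1 + 3 * PowerSeries.X) ^ N := by
      have h3 : ((3 : ℚ[X]) : PowerSeries ℚ) = 3 := map_ofNat (coeToPowerSeries.ringHom) 3
      simp [h3]
    rw [hcoe, mul_assoc, PowerSeries.coeff_C_mul, ← mul_assoc, ← mul_assoc, ← pow_add, add_comm N,
      hpow, mul_zero]

theorem IsMacWilliamsInvariant.exists_coeff_ne_zero {N : ℕ} {P : ℚ[X]}
    (hP : IsMacWilliamsInvariant N P) (hdeg : P.natDegree ≤ N) (hN : 0 < N)
    (h0 : P.coeff 0 = 1) : ∃ j, 0 < j ∧ j ≤ N / 3 + 1 ∧ P.coeff j ≠ 0 := by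
  by_contra! hc
  -- N/3 + 1 is the least m with 3m > N, as a natural exponent e requires.
  have he : (3 * (N / 3 + 1) - N - 1) + N + 1 = 3 * (N / 3 + 1) := by omega
  have h := hP.coeff_eq_zero _ he hdeg
  rw [PowerSeries.coeff_mul, Finset.sum_eq_single (0, N / 3 + 1)] at h
  · rw [coeff_coe, h0, one_mul] at h
    exact PowerSeries.coeff_lagrange_ne_zero he hN h
  · rintro ⟨i, j⟩ hij hne
    rw [Finset.HasAntidiagonal.mem_antidiagonal] at hij
    dsimp only at hij ⊢
    rw [coeff_coe, hc i (Nat.pos_of_ne_zero ?_) (by omega), zero_mul]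
    rintro rfl
    exact hne (by rw [← hij, zero_add])
  · simp

theorem _root_.IsTypeIV.exists_hammingNorm_le {n : ℕ} {C : AddSubgroup (Fin n → RingE)}
    (hC : IsTypeIV C) (hn : 0 < n) :
    ∃ x ∈ C, x ≠ 0 ∧ hammingNorm x ≤ 2 * (n / 6 + 1) := by
  have := Fintype.ofFinite C
  obtain ⟨N, rfl⟩ := even_iff_two_dvd.mp hC.even_length
  have hwt (x : C) : ∃ k, hammingNorm (x : Fin (2 * N) → RingE) = 2 * k ∧ k ≤ N := by
    obtain ⟨k, hk⟩ := even_iff_two_dvd.mp (hC.2 x x.2)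
    have h := hammingNorm_le_card_fintype (x := (x : Fin (2 * N) → RingE))
    rw [Fintype.card_fin] at h
    exact ⟨k, hk, by omega⟩
  choose k hk hkN using hwt
  have hk0 (x : C) : k x = 0 ↔ x = 0 := by
    have h := hammingNorm_eq_zero (x := (x : Fin (2 * N) → RingE))
    rw [hk x] at h
    rw [← ZeroMemClass.coe_eq_zero, ← h]
    omega
  let P : ℚ[X] := ∑ x : C, X ^ k x
  have hcoeff (j : ℕ) : P.coeff j = ∑ x : C, if j = k x then 1 else 0 := by
    simp only [P, finsetSum_coeff, coeff_X_pow]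
  have hinv : IsMacWilliamsInvariant N P := by
    intro x _ _ _ h3
    have h := macWilliams hC.1.sympDual_eq (1 : ℚ) x
    simp only [hk, hC.1.2.2, one_pow, one_mul] at h
    simp only [P, eval_finsetSum, eval_pow, eval_X, ← pow_mul]
    push_cast at h
    rw [show (4 : ℚ) ^ N = 2 ^ (2 * N) by rw [pow_mul]; norm_num, ← h, Finset.mul_sum]
    refine Finset.sum_congr rfl fun z _ => ?_
    rw [div_pow, ← mul_div_assoc, div_eq_iff (pow_ne_zero _ h3), mul_right_comm, ← pow_add]
    have := hkN z
    rw [show 2 * N - 2 * k z + 2 * k z = 2 * N by omega]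
  have hdeg : P.natDegree ≤ N :=
    natDegree_sum_le_of_forall_le _ _ fun x _ => (natDegree_X_pow_le _).trans (hkN x)
  have h0 : P.coeff 0 = 1 := by
    rw [hcoeff, Finset.sum_eq_single 0]
    · simp [(hk0 0).mpr rfl]
    · intro x _ hx
      exact if_neg fun h => hx ((hk0 x).mp h.symm)
    · simp
  obtain ⟨j, hj0, hj, hjc⟩ := hinv.exists_coeff_ne_zero hdeg (by omega) h0
  rw [hcoeff] at hjc
  obtain ⟨x, -, hx⟩ := Finset.exists_ne_zero_of_sum_ne_zero hjc
  have hxj : j = k x := by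
    by_contra h
    exact hx (if_neg h)
  refine ⟨x, x.2, fun h => ?_, ?_⟩
  · have := (hk0 x).mpr (Subtype.ext h)
    omega
  · rw [hk x]
    omega

end Polynomial

/-! ### Minimum distance and conclusion -/

theorem exists_isMinimumDistance_le {A : Type*} [AddGroup A] [DecidableEq A] {n : ℕ}
    {C : AddSubgroup (Fin n → A)} {x : Fin n → A} (hx : x ∈ C) (hx0 : x ≠ 0) :
    ∃ d, IsMinimumDistance (C : Set (Fin n → A)) d ∧ d ≤ hammingNorm x := by
  have hmem : hammingNorm x ∈ codeDistances (C : Set (Fin n → A)) :=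
    ⟨x, hx, 0, C.zero_mem, hx0, hammingDist_zero_right x⟩
  exact ⟨sInf _, ⟨Nat.sInf_mem ⟨_, hmem⟩, fun d hd => Nat.sInf_le hd⟩, Nat.sInf_le hmem⟩

theorem theorem1 {n : ℕ} (C : AddSubgroup (Fin n → RingE)) (hC : IsTypeIV C) :
    -- formal self-duality for the Hamming weight enumerator, as MacWilliams invariance over `E`
    IsFormallySelfDual C ∧
    -- and as equality of the weight enumerators of the attached quaternary code and of its dual
    (∀ ω : F4, ω ^ 2 + ω + 1 = 0 →
      hammingWeightEnumerator (quaternaryImage ω C) =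
        hammingWeightEnumerator (traceDual (quaternaryImage ω C))) ∧
    -- the bound on the minimum distance, and its comparison with `2 ⌊(n + 2) / 4⌋`
    (0 < n →
      (∃ d : ℕ, IsMinimumDistance (C : Set (Fin n → RingE)) d ∧ d ≤ 2 * (n / 6 + 1)) ∧
      2 * (n / 6 + 1) ≤ 2 * ((n + 2) / 4) ∧
      (14 ≤ n → 2 * (n / 6 + 1) < 2 * ((n + 2) / 4))) := by
  refine ⟨hC.1.isFormallySelfDual, fun ω hω => ?_, fun hn => ?_⟩
  · rw [traceDual_quaternaryImage hω, hC.1.sympDual_eq]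
    rfl
  · obtain ⟨x, hx, hx0, hle⟩ := hC.exists_hammingNorm_le hn
    obtain ⟨d, hd, hdx⟩ := exists_isMinimumDistance_le hx hx0
    -- Evenness rules out n = 1, where the comparison of the bounds fails.
    obtain ⟨k, rfl⟩ := hC.even_length
    exact ⟨⟨d, hd, hdx.trans hle⟩, by omega, by omega⟩
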